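/- Let $V$ be either a finite set (the set case), with $\mathcal L(V)$ the lattice of its subsets and $\operatorname{rk}X=\#X$, or a finite-dimensional vector space over a finite field $\mathbb F_q$ (the $q$-analog case), with $\mathcal L(V)$ the lattice of its subspaces and $\operatorname{rk}X=\dim X$. In both cases write $n=\operatorname{rk}V$, write $X\le Y$ for inclusion, and let ${V\brack k}$ be the set of all $X\in\mathcal L(V)$ with $\operatorname{rk}X=k$ (the $k$-subspaces of $V$). For $I\in{V\brack i}$ let $\boldsymbol x^{(k)}_I:{V\brack k}\to\mathbb R$ be the function with $\boldsymbol x^{(k)}_I(K)=1$ if $I\le K$ and $0$ otherwise, and let $\bar V^{(k)}_i\subseteq\mathbb R^{{V\brack k}}$ be the span of all $\boldsymbol x_I^{(k)}$ with $I\in{V\brack i}$. The degree $\deg_V(f)$ of a function $0\ne f:{V\brack k}\to\mathbb R$ is the smallest $t\in\{0,\dots,\min(k,n-k)\}$ with $f\in\bar V^{(k)}_t$, and $\deg_V(0)=-\infty$. For $i\in\{0,\dots,\min(k,n-k)\}$ and $f\in\bar V^{(k)}_i$, the $i$-weight distribution $\operatorname{wt}^{(i)}_f:{V\brack i}\to\mathbb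 R$ is the unique function with $f=\sum_{I\in{V\brack i}}\operatorname{wt}_f^{(i)}(I)\,\boldsymbol x_I^{(k)}$. For a point $P\in{V\brack 1}$, $V/P$ denotes the quotient space, and in the set case the set $V\setminus P$; for $P\le K\le V$ correspondingly $K/P$ is the quotient space in $V/P$, and in the set case $K\setminus P$. **Theorem.** Let $P\in{V\brack 1}$ be a point (so $n\ge1$) and let $1\le k\le n$. Then $$\Phi:\mathbb R^{{V/P\brack k-1}}\to\mathbb R^{{V\brack k}},\qquad \Phi(f):K\mapsto\begin{cases}f(K/P)&\text{if }P\le K,\\0&\text{if }P\nleq K\end{cases}$$ is an injective $\mathbb R$-linear map with image $$\operatorname{im}(\Phi)=\{g\in\mathbb R^{{V\brack k}}\mid g(K)=0\text{ for all }K\in{V\brack k}\text{ with }P\nleq K\},$$ and for all $f:{V/P\brack k-1}\to\mathbb R$ $$\deg_V(\Phi(f))=\min(\deg_{V/P}(f)+1,\;n-k).$$ Moreover, for all $f:{V/P\brack k-1}\to\mathbb R$, all integers $e$ with $\max(\deg_{V/P}(f),0)+1\le e\le\min(k,n-k)$ and all $E\in{V\brack e}$, the weights below exist and are unique, and $$\operatorname{wt}^{(e)}_{\Phi(f)}(E)=\begin{cases}\operatorname{wt}^{(e-1)}_f(E/P)&\text{if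 }P\le E,\\0&\text{if }P\nleq E.\end{cases}$$ -/

import Mathlib

/-- A rank function on a lattice: below it is only used for the cardinality of subsets of a set
and for the dimension of subspaces of a vector space. -/
class HasRank (L : Type*) where
  /-- the rank of an element -/
  rank : L → ℕ

/-- The rank of a subset is its number of elements. -/
noncomputable instance instHasRankSet (V : Type*) : HasRank (Set V) where
  rank X := X.ncard

/-- The rank of a subspace is its dimension. -/
noncomputable instance instHasRankSubmodule (F V : Type*) [Field F] [AddCommGroup V]
    [Module F V] : HasRank (Submodule F V) where
  rank U := Module.finrank F U

/-- A finite-dimensional vector space over a finite field has only finitely many subspaces. -/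
instance instFiniteSubmodule (F V : Type*) [Field F] [Finite F] [AddCommGroup V] [Module F V]
    [Module.Finite F V] : Finite (Submodule F V) :=
  haveI : Finite V := Module.finite_of_finite F
  inferInstance

/-- The set of all elements of rank `k` of the lattice `L`, i.e. the `k`-subsets of `V` for
`L = Set V` and the `k`-dimensional subspaces of `V` for `L = Submodule F V`. -/
def Level (L : Type*) [HasRank L] (k : ℕ) : Type _ :=
  {X : L // HasRank.rank X = k}

noncomputable instance instFintypeLevel (L : Type*) [HasRank L] [Finite L] (k : ℕ) :
    Fintype (Level L k) :=
  haveI : Finite (Level L k) := inferInstanceAs (Finite {X : L // HasRank.rank X = k})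
  Fintype.ofFinite _

open Classical in
/-- The `i`-vs.-`k` incidence matrix `W^{(ik)}`. -/
noncomputable def incMatrix (L : Type*) [HasRank L] [LE L] (i k : ℕ) :
    Matrix (Level L i) (Level L k) ℝ :=
  Matrix.of fun X Y => if X.1 ≤ Y.1 then 1 else 0

/-- The map `φ_↑^{(ki)}`, `a ↦ ∑_I a_I x_I`, described by the transposed incidence matrix:
the value of the image at `K` is the sum of all `a I` with `I ≤ K`. -/
noncomputable def phiUp (L : Type*) [HasRank L] [LE L] [Finite L] (i k : ℕ) :
    (Level L i → ℝ) →ₗ[ℝ] (Level L k → ℝ) :=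
  (incMatrix L i k).transpose.mulVecLin

/-- The row space of the incidence matrix `W^{(ik)}`, the span of the `i`-pencils. -/
noncomputable def rowSpace (L : Type*) [HasRank L] [LE L] [Finite L] (i k : ℕ) :
    Submodule ℝ (Level L k → ℝ) :=
  LinearMap.range (phiUp L i k)

open Classical in
/-- The degree of a real function on the elements of rank `k`: the smallest
`t ∈ {0, …, min(k, n - k)}` (`n` the rank of the ambient space) such that the function lies in the
`t`-th row space; the degree of the zero function is `⊥`, that is, `-∞`. -/
noncomputable def degree {L : Type*} [HasRank L] [LE L] [OrderTop L] [Finite L] {k : ℕ}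
    (f : Level L k → ℝ) : WithBot ℕ :=
  if f = 0 then ⊥
  else ((sInf {t : ℕ | t ≤ min k (HasRank.rank (⊤ : L) - k) ∧ f ∈ rowSpace L t k} : ℕ) :
    WithBot ℕ)

/-- `w` is a family of `i`-weights of `f`, i.e. `f = ∑_I w_I x_I`. -/
def IsWeight {L : Type*} [HasRank L] [LE L] [Finite L] {i k : ℕ}
    (w : Level L i → ℝ) (f : Level L k → ℝ) : Prop :=
  phiUp L i k w = f

open Classical in
/-- The `i`-weight distribution of `f` (set to `0` if `f` has no `i`-weights). -/
noncomputable def wt {L : Type*} [HasRank L] [LE L] [Finite L] (i : ℕ) {k : ℕ}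
    (f : Level L k → ℝ) : Level L i → ℝ :=
  if h : ∃ w : Level L i → ℝ, IsWeight w f then h.choose else 0

/-! The set case: `V / P` is the complement of the one-element set `P`, and `K / P` is
`K \ P`, as a subset of that complement. -/

theorem ncard_preimage_compl {V : Type*} [Finite V] (P K : Set V) (hP : P.ncard = 1)
    (h : P ≤ K) : ((Subtype.val : ↥(Pᶜ) → V) ⁻¹' K).ncard = K.ncard - 1 := by
  have h1 : Subtype.val '' ((Subtype.val : ↥(Pᶜ) → V) ⁻¹' K) = K \ P := by
    ext x
    simp [and_comm]
  rw [← Set.ncard_image_of_injective _ Subtype.val_injective, h1,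
    Set.ncard_sdiff h (Set.toFinite P), hP]

/-- The quotient `K / P = K \ P` for a `k`-subset `K` containing the point `P`. -/
def setMod {V : Type*} [Finite V] (P : Level (Set V) 1) {k : ℕ} (K : Level (Set V) k)
    (h : P.1 ≤ K.1) : Level (Set ↥(P.1ᶜ)) (k - 1) :=
  ⟨Subtype.val ⁻¹' K.1, by
    have hK : K.1.ncard = k := K.2
    exact (ncard_preimage_compl P.1 K.1 P.2 h).trans (by rw [hK])⟩

open Classical in
/-- Extension by zero from the `(k-1)`-subsets of `V / P` to the `k`-subsets of `V`. -/
noncomputable def setPhi {V : Type*} [Finite V] (P : Level (Set V) 1) (k : ℕ)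
    (f : Level (Set ↥(P.1ᶜ)) (k - 1) → ℝ) : Level (Set V) k → ℝ :=
  fun K => if h : P.1 ≤ K.1 then f (setMod P K h) else 0

/-! The vector space case: `V / P` is the quotient space, and `K / P` is the image of `K`. -/

theorem finrank_map_mkQ {F V : Type*} [Field F] [AddCommGroup V] [Module F V]
    [Module.Finite F V] (P K : Submodule F V) (hP : Module.finrank F P = 1) (h : P ≤ K) :
    Module.finrank F (K.map P.mkQ) = Module.finrank F K - 1 := by
  have h1 := (P.mkQ.domRestrict K).finrank_range_add_finrank_ker
  have h2 : LinearMap.ker (P.mkQ.domRestrict K) = P.comap K.subtype := by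
    ext x
    simp
  rw [LinearMap.range_domRestrict, h2,
    (Submodule.comapSubtypeEquivOfLe h).finrank_eq, hP] at h1
  omega

/-- The quotient space `K / P` for a `k`-subspace `K` containing the point `P`. -/
def spaceMod {F V : Type*} [Field F] [AddCommGroup V] [Module F V] [Module.Finite F V]
    (P : Level (Submodule F V) 1) {k : ℕ} (K : Level (Submodule F V) k) (h : P.1 ≤ K.1) :
    Level (Submodule F (V ⧸ P.1)) (k - 1) :=
  ⟨K.1.map P.1.mkQ, by
    have hK : Module.finrank F K.1 = k := K.2
    exact (finrank_map_mkQ P.1 K.1 P.2 h).trans (by rw [hK])⟩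

open Classical in
/-- Extension by zero from the `(k-1)`-subspaces of `V / P` to the `k`-subspaces of `V`. -/
noncomputable def spacePhi {F V : Type*} [Field F] [AddCommGroup V] [Module F V]
    [Module.Finite F V] (P : Level (Submodule F V) 1) (k : ℕ)
    (f : Level (Submodule F (V ⧸ P.1)) (k - 1) → ℝ) : Level (Submodule F V) k → ℝ :=
  fun K => if h : P.1 ≤ K.1 then f (spaceMod P K h) else 0

/-! Both cases are modular lattices in which every interval of rank `r` has `a r` atoms: `r` of them
for sets, `(q^r - 1)/(q - 1)` for subspaces. The elements above `P` form the lattice of `V/P`, so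
`(e-1)`-weights of `f`, extended by zero, are `e`-weights of `Φ(f)` (`QuotientIso.phiUp_extend`).
Hence `deg Φ(f) ≤ deg f + 1` as long as `deg f + 1 ≤ n - k`.

Conversely, let `w` be `t`-weights of `Φ(f)` with `t ≤ k` and `t + k < n`. An element `E` not above
`P` lies in a hyperplane `H` not above `P`. On the `k`-elements below `H` the function `Φ(f)`
vanishes, and since `t + k ≤ n - 1 = rk H`, weights inside `H` are unique; so `w(E) = 0`
(`eq_zero_of_not_le`). Thus `w` is an extension by zero and descends to `(t-1)`-weights of `f`. For
`t = n - k` no such `H` is large enough, whence the cap in the degree formula.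

Uniqueness of weights (`phiUp_injective`) is an `sl₂`-type argument. With `U` the cover matrix and
`D` its transpose, `DU - UD` is diagonal with entry `a(n-r) - a(r)` on rank `r`
(`coverMatrix_commutator`), and this forces `U^m` to be injective on rank `i` when `2i + m ≤ n`.
Ranks `k` and `n - k` are equinumerous, so the row space at `min k (n - k)` is everything
(`rowSpace_min_eq_top`) and the degree is attained. -/

/-! ### Uniformly graded lattices; raising and lowering operators -/

/-- A finite lattice with a modular rank function such that every interval of rank `r` has exactly
`a r` atoms, where `a` is strictly increasing. -/
structure IsUniformlyGraded {L : Type*} [Lattice L] [OrderBot L] (rk : L → ℕ) (a : ℕ → ℝ) :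
    Prop where
  atoms_strictMono : StrictMono a
  rank_strictMono : StrictMono rk
  rank_bot : rk ⊥ = 0
  rank_sup_add_rank_inf : ∀ x y, rk (x ⊔ y) + rk (x ⊓ y) = rk x + rk y
  ncard_atoms : ∀ x y, x ≤ y →
    ({z | x ≤ z ∧ z ≤ y ∧ rk z = rk x + 1}.ncard : ℝ) = a (rk y - rk x)

open Classical in
/-- The incidence matrix of the covering relation; rows are indexed by the upper elements. -/
noncomputable def coverMatrix {L : Type*} [LE L] (rk : L → ℕ) : Matrix L L ℝ :=
  Matrix.of fun y x => if x ≤ y ∧ rk y = rk x + 1 then 1 else 0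

open Classical in
/-- The incidence matrix of the order relation; rows are indexed by the upper elements. -/
noncomputable def orderMatrix (L : Type*) [LE L] : Matrix L L ℝ :=
  Matrix.of fun y x => if x ≤ y then 1 else 0

/-- The function `w` vanishes outside the elements of rank `i`. -/
def SupportedAt {L : Type*} (rk : L → ℕ) (i : ℕ) (w : L → ℝ) : Prop :=
  ∀ x, rk x ≠ i → w x = 0

section Support

open Matrix

variable {L : Type*} [LE L] [Fintype L] {rk : L → ℕ}

theorem supportedAt_cover {w : L → ℝ} {i : ℕ} (hw : SupportedAt rk i w) :
    SupportedAt rk (i + 1) (coverMatrix rk *ᵥ w) := by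
  intro y hy
  simp only [Matrix.mulVec, dotProduct, coverMatrix, Matrix.of_apply]
  refine Finset.sum_eq_zero fun x _ => ?_
  by_cases hx : rk x = i
  · rw [if_neg (by rintro ⟨-, h⟩; omega), zero_mul]
  · rw [hw x hx, mul_zero]

theorem supportedAt_cover_transpose {w : L → ℝ} {i : ℕ} (hw : SupportedAt rk (i + 1) w) :
    SupportedAt rk i ((coverMatrix rk)ᵀ *ᵥ w) := by
  intro y hy
  simp only [Matrix.mulVec, dotProduct, coverMatrix, Matrix.of_apply, Matrix.transpose_apply]
  refine Finset.sum_eq_zero fun x _ => ?_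
  by_cases hx : rk x = i + 1
  · rw [if_neg (by rintro ⟨-, h⟩; omega), zero_mul]
  · rw [hw x hx, mul_zero]

theorem cover_transpose_eq_zero {w : L → ℝ} (hw : SupportedAt rk 0 w) :
    (coverMatrix rk)ᵀ *ᵥ w = 0 := by
  ext y
  simp only [Matrix.mulVec, dotProduct, coverMatrix, Matrix.of_apply, Matrix.transpose_apply]
  refine Finset.sum_eq_zero fun x _ => ?_
  by_cases hx : rk x = 0
  · rw [if_neg (by rintro ⟨-, h⟩; omega), zero_mul]
  · rw [hw x hx, mul_zero]

open Classical in
theorem supportedAt_cover_pow {w : L → ℝ} {i : ℕ} (hw : SupportedAt rk i w) (m : ℕ) :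
    SupportedAt rk (i + m) (coverMatrix rk ^ m *ᵥ w) := by
  induction m with
  | zero => simpa using hw
  | succ m ih =>
    rw [pow_succ', ← Matrix.mulVec_mulVec]
    exact supportedAt_cover ih

end Support

open Matrix Classical in
theorem diagonal_mulVec_of_supportedAt {L : Type*} [Fintype L] {rk : L → ℕ}
    {w : L → ℝ} {i : ℕ} (hw : SupportedAt rk i w)
    (c : ℕ → ℝ) : Matrix.diagonal (fun x => c (rk x)) *ᵥ w = c i • w := by
  ext x
  rw [Matrix.mulVec_diagonal, Pi.smul_apply, smul_eq_mul]
  by_cases hx : rk x = i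
  · rw [hx]
  · rw [hw x hx, mul_zero, mul_zero]

namespace IsUniformlyGraded

/-! ### Atoms and coatoms of intervals -/

section Counting

variable {L : Type*} [Lattice L] [OrderBot L] {rk : L → ℕ} {a : ℕ → ℝ}

theorem eq_of_le_of_rank_le (h : IsUniformlyGraded rk a) {x y : L} (hxy : x ≤ y)
    (hr : rk y ≤ rk x) : x = y := by
  by_contra hne
  exact absurd (h.rank_strictMono (lt_of_le_of_ne hxy hne)) (by omega)

theorem rank_mono (h : IsUniformlyGraded rk a) {x y : L} (hxy : x ≤ y) : rk x ≤ rk y :=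
  h.rank_strictMono.monotone hxy

theorem atoms_zero (h : IsUniformlyGraded rk a) : a 0 = 0 := by
  have h1 := h.ncard_atoms ⊥ ⊥ le_rfl
  have h2 : {z : L | ⊥ ≤ z ∧ z ≤ ⊥ ∧ rk z = rk ⊥ + 1} = ∅ := by
    ext z
    simp only [Set.mem_ofPred_eq, Set.mem_empty_iff_false, iff_false, not_and]
    rintro - hz
    have := h.rank_mono hz
    omega
  rw [h2] at h1
  simpa using h1.symm

theorem atoms_pos (h : IsUniformlyGraded rk a) {r : ℕ} (hr : 0 < r) : 0 < a r := by
  simpa [h.atoms_zero] using h.atoms_strictMono hr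

/-- Double counting of pairs atom ≤ coatom in `[x, y]`: by induction each atom lies below `a r`
coatoms, each coatom lies above `a r` atoms, and `a r` cancels. -/
theorem ncard_coatoms [Finite L] (h : IsUniformlyGraded rk a) (x y : L) (hxy : x ≤ y) :
    ({z | x ≤ z ∧ z ≤ y ∧ rk y = rk z + 1}.ncard : ℝ) = a (rk y - rk x) := by
  classical
  have := Fintype.ofFinite L
  obtain ⟨r, hr⟩ : ∃ r, rk y - rk x = r := ⟨_, rfl⟩
  induction r generalizing x with
  | zero =>
    have hx : x = y := h.eq_of_le_of_rank_le hxy (by omega)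
    subst hx
    have h2 : {z : L | x ≤ z ∧ z ≤ x ∧ rk x = rk z + 1} = ∅ := by
      ext z
      simp only [Set.mem_ofPred_eq, Set.mem_empty_iff_false, iff_false, not_and]
      rintro hz -
      have := h.rank_mono hz
      omega
    simp [h2, h.atoms_zero]
  | succ r ih =>
    -- In an interval of rank one the factor `a 0 = 0` cannot be cancelled, so this case is done by
    -- hand.
    rcases Nat.eq_zero_or_pos r with rfl | hr0
    · rw [← h.ncard_atoms x y hxy]
      have h1 : {z : L | x ≤ z ∧ z ≤ y ∧ rk y = rk z + 1} = {x} := by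
        ext z
        simp only [Set.mem_ofPred_eq, Set.mem_singleton_iff]
        constructor
        · rintro ⟨h1, h2, h3⟩
          exact (h.eq_of_le_of_rank_le h1 (by omega)).symm
        · rintro rfl
          exact ⟨le_rfl, hxy, by omega⟩
      have h2 : {z : L | x ≤ z ∧ z ≤ y ∧ rk z = rk x + 1} = {y} := by
        ext z
        simp only [Set.mem_ofPred_eq, Set.mem_singleton_iff]
        constructor
        · rintro ⟨h1, h2, h3⟩
          exact h.eq_of_le_of_rank_le h2 (by omega)
        · rintro rfl
          exact ⟨hxy, le_rfl, by omega⟩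
      rw [h1, h2, Set.ncard_singleton, Set.ncard_singleton]
    · set A : Finset L := Finset.univ.filter fun p => x ≤ p ∧ p ≤ y ∧ rk p = rk x + 1 with hA
      set B : Finset L := Finset.univ.filter fun c => x ≤ c ∧ c ≤ y ∧ rk y = rk c + 1 with hB
      have hAc : (A.card : ℝ) = a (r + 1) := by
        rw [← hr, ← h.ncard_atoms x y hxy, ← Set.ncard_coe_finset, hA]
        simp
      have key := Finset.sum_card_bipartiteAbove_eq_sum_card_bipartiteBelow
        (s := A) (t := B) (fun p c => p ≤ c)
      have key' : (∑ p ∈ A, ((B.bipartiteAbove (fun p c => p ≤ c) p).card : ℝ)) =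
          ∑ c ∈ B, ((A.bipartiteBelow (fun p c => p ≤ c) c).card : ℝ) := by
        exact_mod_cast key
      have e1 : ∀ p ∈ A, ((B.bipartiteAbove (fun p c => p ≤ c) p).card : ℝ) = a r := by
        intro p hp
        simp only [hA, Finset.mem_filter, Finset.mem_univ, true_and] at hp
        have hi := ih p hp.2.1 (by omega)
        rw [show rk y - rk p = r by omega] at hi
        rw [← hi, ← Set.ncard_coe_finset]
        congr 2
        ext c
        simp only [Finset.coe_bipartiteAbove, hB, Set.mem_ofPred_eq, Finset.mem_filter,
          Finset.mem_univ, true_and]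
        exact ⟨fun hc => ⟨hc.2, hc.1.2⟩, fun hc => ⟨⟨hp.1.trans hc.1, hc.2⟩, hc.1⟩⟩
      have e2 : ∀ c ∈ B, ((A.bipartiteBelow (fun p c => p ≤ c) c).card : ℝ) = a r := by
        intro c hc
        simp only [hB, Finset.mem_filter, Finset.mem_univ, true_and] at hc
        have hi := h.ncard_atoms x c hc.1
        rw [show rk c - rk x = r by omega] at hi
        rw [← hi, ← Set.ncard_coe_finset]
        congr 2
        ext p
        simp only [Finset.coe_bipartiteBelow, hA, Set.mem_ofPred_eq, Finset.mem_filter,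
          Finset.mem_univ, true_and]
        exact ⟨fun hp => ⟨hp.1.1, hp.2, hp.1.2.2⟩,
          fun hp => ⟨⟨hp.1, hp.2.1.trans hc.2.1, hp.2.2⟩, hp.2.1⟩⟩
      rw [Finset.sum_congr rfl e1, Finset.sum_congr rfl e2] at key'
      simp only [Finset.sum_const, nsmul_eq_mul] at key'
      have hBA := mul_right_cancel₀ (h.atoms_pos hr0).ne' key'
      rw [hr, ← hAc, hBA, ← Set.ncard_coe_finset, hB]
      simp

/-- Lower intervals inherit the uniform grading. -/
theorem restrict_Iic (h : IsUniformlyGraded rk a) (t : L) :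
    IsUniformlyGraded (fun x : Set.Iic t => rk x.1) a where
  atoms_strictMono := h.atoms_strictMono
  rank_strictMono := fun _ _ hxy => h.rank_strictMono hxy
  rank_bot := h.rank_bot
  rank_sup_add_rank_inf := fun x y => h.rank_sup_add_rank_inf x.1 y.1
  ncard_atoms := fun x y hxy => by
    rw [← h.ncard_atoms x.1 y.1 hxy, ← Set.ncard_image_of_injective _ Subtype.val_injective]
    congr 2
    ext z
    simp only [Set.mem_image, Set.mem_ofPred_eq, Subtype.exists]
    constructor
    · rintro ⟨z', hz', hh, rfl⟩
      exact hh
    · rintro hh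
      exact ⟨z, hh.2.1.trans y.2, hh, rfl⟩

/-- Single summands may be negative. Reversing the order of the subtracted terms pairs `n - (i + j)`
with `i + (m - j)`, which is strictly smaller. -/
theorem sum_atoms_pos (h : IsUniformlyGraded rk a) {n i m : ℕ} (hn : 2 * i + (m + 1) ≤ n) :
    0 < ∑ j ∈ Finset.range (m + 1), (a (n - (i + j)) - a (i + j)) := by
  rw [Finset.sum_sub_distrib, ← Finset.sum_range_reflect (fun j => a (i + j)),
    ← Finset.sum_sub_distrib]
  refine Finset.sum_pos (fun j hj => sub_pos.2 (h.atoms_strictMono ?_)) (by simp)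
  rw [Finset.mem_range] at hj
  omega

end Counting

/-! ### Commutation relation and injectivity of the raising operator -/

section Operators

variable {L : Type*} [Lattice L] [BoundedOrder L] [Fintype L] {rk : L → ℕ} {a : ℕ → ℝ}

-- Off the diagonal, two distinct elements of equal rank have at most one common cover, `x ⊔ y`, and
-- cover at most one common element, `x ⊓ y`; by modularity one occurs exactly when the other does.
-- The diagonal counts upper covers minus lower covers.
open Classical in
theorem coverMatrix_commutator (h : IsUniformlyGraded rk a) :
    (coverMatrix rk).transpose * coverMatrix rk = coverMatrix rk * (coverMatrix rk).transpose +
      Matrix.diagonal fun x => a (rk ⊤ - rk x) - a (rk x) := by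
  ext x y
  simp only [Matrix.mul_apply, Matrix.add_apply, coverMatrix, Matrix.of_apply,
    Matrix.transpose_apply, ← ite_and, mul_ite, mul_one, mul_zero]
  by_cases hxy : x = y
  · subst hxy
    simp only [Matrix.diagonal_apply_eq, and_self, Finset.sum_boole]
    have h1 := h.ncard_atoms x ⊤ le_top
    have h2 := h.ncard_coatoms ⊥ x bot_le
    simp only [le_top, bot_le, true_and, h.rank_bot, Nat.sub_zero] at h1 h2
    rw [← h1, ← h2]
    simp [← Set.ncard_coe_finset]
  · rw [Matrix.diagonal_apply_ne _ hxy, add_zero]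
    by_cases hr : rk x = rk y
    · have hm := h.rank_sup_add_rank_inf x y
      have hlt : rk x < rk (x ⊔ y) := by
        refine h.rank_strictMono (lt_of_le_of_ne le_sup_left fun he => hxy ?_)
        have : y ≤ x := he ▸ le_sup_right
        exact (h.eq_of_le_of_rank_le this hr.le).symm
      rw [Finset.sum_eq_single (x ⊔ y), Finset.sum_eq_single (x ⊓ y)]
      · have : rk (x ⊔ y) = rk x + 1 ↔ rk x = rk (x ⊓ y) + 1 := by omega
        rw [hr] at this
        simp [this, hr]
      · intro z _ hz
        rw [if_neg]
        rintro ⟨⟨h1, h2⟩, h3, h4⟩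
        refine hz (h.eq_of_le_of_rank_le (le_inf ?_ ?_) ?_)
        · assumption
        · assumption
        · omega
      · simp
      · intro z _ hz
        rw [if_neg]
        rintro ⟨⟨h1, h2⟩, h3, h4⟩
        refine hz (h.eq_of_le_of_rank_le (sup_le ?_ ?_) ?_).symm
        · assumption
        · assumption
        · omega
      · simp
    · rw [Finset.sum_eq_zero, Finset.sum_eq_zero]
      · intro z _
        rw [if_neg]
        rintro ⟨⟨h1, h2⟩, h3, h4⟩
        omega
      · intro z _
        rw [if_neg]
        rintro ⟨⟨h1, h2⟩, h3, h4⟩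
        omega

open Matrix

open Classical in
theorem cover_transpose_mulVec_cover_pow (h : IsUniformlyGraded rk a) {w : L → ℝ} {i : ℕ}
    (hw : SupportedAt rk i w) (m : ℕ) :
    (coverMatrix rk)ᵀ *ᵥ (coverMatrix rk ^ (m + 1) *ᵥ w) =
      coverMatrix rk ^ (m + 1) *ᵥ ((coverMatrix rk)ᵀ *ᵥ w) +
        (∑ j ∈ Finset.range (m + 1), (a (rk (⊤ : L) - (i + j)) - a (i + j))) •
          (coverMatrix rk ^ m *ᵥ w) := by
  have comm : ∀ {v : L → ℝ} {j : ℕ}, SupportedAt rk j v →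
      (coverMatrix rk)ᵀ *ᵥ (coverMatrix rk *ᵥ v) = coverMatrix rk *ᵥ ((coverMatrix rk)ᵀ *ᵥ v) +
        (a (rk (⊤ : L) - j) - a j) • v := by
    intro v j hv
    rw [Matrix.mulVec_mulVec, h.coverMatrix_commutator, Matrix.add_mulVec,
      ← Matrix.mulVec_mulVec,
      diagonal_mulVec_of_supportedAt hv (fun j => a (rk (⊤ : L) - j) - a j)]
  induction m with
  | zero => simpa using comm hw
  | succ m ih =>
    rw [pow_succ' _ (m + 1), ← Matrix.mulVec_mulVec, comm (supportedAt_cover_pow hw (m + 1)), ih,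
      Matrix.mulVec_add, Matrix.mulVec_smul, Matrix.mulVec_mulVec, Matrix.mulVec_mulVec,
      ← pow_succ', Finset.sum_range_succ _ (m + 1), add_smul, Matrix.mulVec_mulVec, ← pow_succ',
      add_assoc]

-- Applying `D` to `U^(m+1) w = 0` gives `U^(m+1) D w + s U^m w = 0` with `s > 0`. Once `D w = 0` is
-- known, `U^m w = 0` and `m` drops.
open Classical in
theorem eq_zero_of_cover_pow_mulVec (h : IsUniformlyGraded rk a) {i m : ℕ} {w : L → ℝ}
    (hw : SupportedAt rk i w) (hn : 2 * i + m ≤ rk (⊤ : L))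
    (h0 : coverMatrix rk ^ m *ᵥ w = 0) : w = 0 := by
  induction i generalizing m w with
  | zero =>
    induction m with
    | zero => simpa using h0
    | succ m ih =>
      have key := h.cover_transpose_mulVec_cover_pow hw m
      rw [h0, cover_transpose_eq_zero hw, Matrix.mulVec_zero, Matrix.mulVec_zero, zero_add] at key
      exact ih (by omega) ((smul_eq_zero.1 key.symm).resolve_left (h.sum_atoms_pos hn).ne')
  | succ i ihi =>
    induction m with
    | zero => simpa using h0
    | succ m ih =>
      have key := h.cover_transpose_mulVec_cover_pow hw m
      set s := ∑ j ∈ Finset.range (m + 1), (a (rk (⊤ : L) - (i + 1 + j)) - a (i + 1 + j)) with hs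
      have hs0 : 0 < s := h.sum_atoms_pos hn
      -- A further `U` kills the second term, leaving `U^(m+2) D w = 0`; `D w` has rank one less, so
      -- `2i + m` keeps its bound and the induction on `i` applies.
      have hD := supportedAt_cover_transpose hw
      rw [h0, Matrix.mulVec_zero] at key
      have hDw : (coverMatrix rk)ᵀ *ᵥ w = 0 := by
        refine ihi (m := m + 2) hD (by omega) ?_
        have := congrArg (fun v => coverMatrix rk *ᵥ v) key
        simp only [Matrix.mulVec_zero, Matrix.mulVec_add, Matrix.mulVec_smul] at this
        rw [Matrix.mulVec_mulVec _ _ (coverMatrix rk ^ m), ← pow_succ', h0, smul_zero, add_zero,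
          Matrix.mulVec_mulVec, ← pow_succ'] at this
        exact this.symm
      rw [hDw, Matrix.mulVec_zero, zero_add] at key
      exact ih (by omega) ((smul_eq_zero.1 key.symm).resolve_left hs0.ne')

/-- The entry counts the `z ≤ y` covering `x`, i.e. the atoms of `[x, y]`. It converts weights on
one rank into weights on the next, up to a scalar. -/
theorem orderMatrix_mul_coverMatrix (h : IsUniformlyGraded rk a) (y x : L) :
    (orderMatrix L * coverMatrix rk) y x = a (rk y - rk x) * orderMatrix L y x := by
  classical
  simp only [Matrix.mul_apply, orderMatrix, coverMatrix, Matrix.of_apply, ← ite_and, mul_ite,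
    mul_one, mul_zero]
  by_cases hxy : x ≤ y
  · rw [if_pos hxy, ← h.ncard_atoms x y hxy, Finset.sum_boole, ← Set.ncard_coe_finset]
    congr 2
    ext z
    simp only [Finset.coe_filter, Finset.mem_univ, true_and, Set.mem_ofPred_eq]
    tauto
  · rw [if_neg hxy]
    refine Finset.sum_eq_zero fun z _ => if_neg ?_
    rintro ⟨⟨h1, -⟩, h2⟩
    exact hxy (h1.trans h2)

theorem orderMatrix_mulVec_cover (h : IsUniformlyGraded rk a) {w : L → ℝ} {i : ℕ}
    (hw : SupportedAt rk i w) (y : L) :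
    (orderMatrix L *ᵥ (coverMatrix rk *ᵥ w)) y = a (rk y - i) * (orderMatrix L *ᵥ w) y := by
  rw [Matrix.mulVec_mulVec]
  simp only [Matrix.mulVec, dotProduct, h.orderMatrix_mul_coverMatrix, Finset.mul_sum]
  refine Finset.sum_congr rfl fun x _ => ?_
  by_cases hx : rk x = i
  · rw [hx, mul_assoc]
  · rw [hw x hx]
    simp

/-- If `w` lives on rank `i` and the order matrix applied to `w` vanishes on rank `i + m`, then so
does the `m`-th power of the cover matrix applied to `w`. -/
theorem cover_pow_eq_zero (h : IsUniformlyGraded rk a) {i m : ℕ} {w : L → ℝ}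
    [DecidableEq L] (hw : SupportedAt rk i w)
    (h0 : ∀ y, rk y = i + m → (orderMatrix L *ᵥ w) y = 0) : coverMatrix rk ^ m *ᵥ w = 0 := by
  induction m generalizing i w with
  | zero =>
    rw [pow_zero, Matrix.one_mulVec]
    ext y
    by_cases hy : rk y = i
    · rw [Pi.zero_apply, ← h0 y hy]
      simp only [Matrix.mulVec, dotProduct, orderMatrix, Matrix.of_apply]
      rw [Finset.sum_eq_single y]
      · simp
      · intro x _ hxy
        by_cases hx : rk x = i
        · rw [if_neg fun hle => hxy (h.eq_of_le_of_rank_le hle (by omega)), zero_mul]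
        · rw [hw x hx, mul_zero]
      · simp
    · exact hw y hy
  | succ m ih =>
    rw [pow_succ, ← Matrix.mulVec_mulVec]
    refine ih (supportedAt_cover hw) fun y hy => ?_
    rw [h.orderMatrix_mulVec_cover hw, h0 y (by omega), mul_zero]

theorem eq_zero_of_orderMatrix_mulVec (h : IsUniformlyGraded rk a) {i k : ℕ} {w : L → ℝ}
    (hw : SupportedAt rk i w) (hik : i ≤ k) (hn : i + k ≤ rk (⊤ : L))
    (h0 : ∀ y, rk y = k → (orderMatrix L *ᵥ w) y = 0) : w = 0 := by
  classical
  obtain ⟨m, rfl⟩ := Nat.exists_eq_add_of_le hik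
  exact h.eq_zero_of_cover_pow_mulVec hw (by omega) (h.cover_pow_eq_zero hw h0)

theorem exists_supportedAt_of_le (h : IsUniformlyGraded rk a) {i j k : ℕ} {w : L → ℝ}
    (hw : SupportedAt rk i w) (hij : i ≤ j) (hjk : j ≤ k) :
    ∃ w', SupportedAt rk j w' ∧
      ∀ y, rk y = k → (orderMatrix L *ᵥ w') y = (orderMatrix L *ᵥ w) y := by
  induction j, hij using Nat.le_induction with
  | base => exact ⟨w, hw, fun _ _ => rfl⟩
  | succ j hij ih =>
    obtain ⟨v, hv, hv'⟩ := ih (by omega)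
    have hpos : 0 < a (k - j) := h.atoms_pos (by omega)
    refine ⟨(a (k - j))⁻¹ • (coverMatrix rk *ᵥ v), fun x hx => ?_, fun y hy => ?_⟩
    · rw [Pi.smul_apply, supportedAt_cover hv x hx, smul_zero]
    · rw [Matrix.mulVec_smul, Pi.smul_apply, h.orderMatrix_mulVec_cover hv, hy, hv' y hy,
        smul_eq_mul, inv_mul_cancel_left₀ hpos.ne']

theorem ncard_rank_succ (h : IsUniformlyGraded rk a) (j : ℕ) :
    ({x : L | rk x = j + 1}.ncard : ℝ) * a (j + 1) =
      {x : L | rk x = j}.ncard * a (rk (⊤ : L) - j) := by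
  classical
  set A : Finset L := Finset.univ.filter fun x => rk x = j with hA
  set B : Finset L := Finset.univ.filter fun x => rk x = j + 1 with hB
  have key := Finset.sum_card_bipartiteAbove_eq_sum_card_bipartiteBelow
    (s := A) (t := B) (fun p c => p ≤ c)
  have key' : (∑ p ∈ A, ((B.bipartiteAbove (fun p c => p ≤ c) p).card : ℝ)) =
      ∑ c ∈ B, ((A.bipartiteBelow (fun p c => p ≤ c) c).card : ℝ) := by
    exact_mod_cast key
  have e1 : ∀ p ∈ A, ((B.bipartiteAbove (fun p c => p ≤ c) p).card : ℝ) =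
      a (rk (⊤ : L) - j) := by
    intro p hp
    simp only [hA, Finset.mem_filter, Finset.mem_univ, true_and] at hp
    rw [← hp, ← h.ncard_atoms p ⊤ le_top, ← Set.ncard_coe_finset]
    congr 2
    ext c
    simp only [Finset.coe_bipartiteAbove, hB, Set.mem_ofPred_eq, Finset.mem_filter,
      Finset.mem_univ, true_and, le_top, hp]
    tauto
  have e2 : ∀ c ∈ B, ((A.bipartiteBelow (fun p c => p ≤ c) c).card : ℝ) = a (j + 1) := by
    intro c hc
    simp only [hB, Finset.mem_filter, Finset.mem_univ, true_and] at hc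
    have h1 := h.ncard_coatoms ⊥ c bot_le
    rw [h.rank_bot, hc, Nat.sub_zero] at h1
    rw [← h1, ← Set.ncard_coe_finset]
    congr 2
    ext p
    simp only [Finset.coe_bipartiteBelow, hA, Set.mem_ofPred_eq, Finset.mem_filter,
      Finset.mem_univ, true_and, bot_le, Nat.add_right_cancel_iff, eq_comm (a := j)]
    tauto
  rw [Finset.sum_congr rfl e1, Finset.sum_congr rfl e2] at key'
  simp only [Finset.sum_const, nsmul_eq_mul, ← Set.ncard_coe_finset] at key'
  simpa [hA, hB] using key'.symm

/-- Counting covers between consecutive ranks gives the same recursion read upwards from `⊥` and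
downwards from `⊤`. -/
theorem ncard_rank_eq_ncard_corank (h : IsUniformlyGraded rk a) {j : ℕ} (hj : j ≤ rk (⊤ : L)) :
    {x : L | rk x = j}.ncard = {x : L | rk x = rk (⊤ : L) - j}.ncard := by
  induction j with
  | zero =>
    have h1 : {x : L | rk x = 0} = {⊥} := by
      ext x
      refine ⟨fun hx => ?_, fun hx => by rw [hx]; exact h.rank_bot⟩
      have hx : rk x = 0 := hx
      exact (h.eq_of_le_of_rank_le bot_le (by omega)).symm
    have h2 : {x : L | rk x = rk (⊤ : L) - 0} = {⊤} := by
      ext x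
      refine ⟨fun hx => ?_, fun hx => by rw [hx]; rfl⟩
      have hx : rk x = rk (⊤ : L) - 0 := hx
      exact h.eq_of_le_of_rank_le le_top (by omega)
    rw [h1, h2, Set.ncard_singleton, Set.ncard_singleton]
  | succ j ih =>
    have h1 := h.ncard_rank_succ j
    have h2 := h.ncard_rank_succ (rk (⊤ : L) - (j + 1))
    rw [show rk (⊤ : L) - (j + 1) + 1 = rk (⊤ : L) - j by omega,
      show rk (⊤ : L) - (rk (⊤ : L) - (j + 1)) = j + 1 by omega, ← ih (by omega), ← h1] at h2
    exact_mod_cast mul_right_cancel₀ (h.atoms_pos (Nat.succ_pos j)).ne' h2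

end Operators

end IsUniformlyGraded

/-! ### Weights on levels as functions on the whole lattice -/

section Levels

variable {L : Type*} [HasRank L] [LE L] [Finite L]

open Classical in
theorem phiUp_apply {i k : ℕ} (w : Level L i → ℝ) (K : Level L k) :
    phiUp L i k w K = ∑ I : Level L i, if I.1 ≤ K.1 then w I else 0 := by
  rw [phiUp, Matrix.mulVecLin_apply]
  simp only [Matrix.mulVec, dotProduct, incMatrix, Matrix.transpose_apply, Matrix.of_apply, ite_mul,
    one_mul, zero_mul]

theorem mem_rowSpace_iff {i k : ℕ} {f : Level L k → ℝ} :
    f ∈ rowSpace L i k ↔ ∃ w : Level L i → ℝ, IsWeight w f :=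
  Iff.rfl

open Matrix in
theorem phiUp_restrict [Fintype L] {i k : ℕ} {v : L → ℝ} (hv : SupportedAt HasRank.rank i v)
    (K : Level L k) : phiUp L i k (fun I => v I.1) K = (orderMatrix L *ᵥ v) K.1 := by
  classical
  rw [phiUp_apply]
  simp only [Matrix.mulVec, dotProduct, orderMatrix, Matrix.of_apply]
  refine Finset.sum_of_injOn (fun I : Level L i => I.1) Subtype.val_injective.injOn
    (by simp) (fun x _ hx => ?_) (fun I _ => by simp)
  rw [hv x fun hr => hx ⟨⟨x, hr⟩, Finset.mem_coe.2 (Finset.mem_univ _), rfl⟩, mul_zero]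

open Classical in
/-- Extension by zero of a function on the elements of rank `i`. -/
noncomputable def levelExtend {L : Type*} [HasRank L] {i : ℕ} (w : Level L i → ℝ) : L → ℝ :=
  fun x => if h : HasRank.rank x = i then w ⟨x, h⟩ else 0

theorem levelExtend_apply {L : Type*} [HasRank L] {i : ℕ} (w : Level L i → ℝ) (I : Level L i) :
    levelExtend w I.1 = w I :=
  dif_pos I.2

theorem supportedAt_levelExtend {L : Type*} [HasRank L] {i : ℕ} (w : Level L i → ℝ) :
    SupportedAt HasRank.rank i (levelExtend w) :=
  fun _ hx => dif_neg hx

open Matrix in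
theorem orderMatrix_mulVec_levelExtend [Fintype L] {i k : ℕ} (w : Level L i → ℝ)
    (K : Level L k) : (orderMatrix L *ᵥ levelExtend w) K.1 = phiUp L i k w K := by
  rw [← phiUp_restrict (supportedAt_levelExtend w)]
  simp only [levelExtend_apply]

theorem wt_eq_of_isWeight {i k : ℕ} (hinj : Function.Injective (phiUp L i k))
    {w : Level L i → ℝ} {f : Level L k → ℝ} (hw : IsWeight w f) : wt i f = w := by
  have hex : ∃ w : Level L i → ℝ, IsWeight w f := ⟨w, hw⟩
  rw [wt, dif_pos hex]
  exact hinj (hex.choose_spec.trans hw.symm)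

theorem existsUnique_isWeight {i k : ℕ} (hinj : Function.Injective (phiUp L i k))
    {w : Level L i → ℝ} {f : Level L k → ℝ} (hw : IsWeight w f) :
    ∃! w : Level L i → ℝ, IsWeight w f :=
  ⟨w, hw, fun _ hv => hinj (hv.trans hw.symm)⟩

end Levels

/-- The hyperplane is `E ⊔ C` for a complement `C` of `E ⊔ P`; modularity gives its rank, and
containing `P` would make it `⊤`. -/
theorem exists_rank_succ_of_not_le {L : Type*} [Lattice L] [BoundedOrder L]
    [ComplementedLattice L] [HasRank L] {a : ℕ → ℝ}
    (h : IsUniformlyGraded (HasRank.rank : L → ℕ) a) {P E : L} (hP : HasRank.rank P = 1)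
    (hE : ¬ P ≤ E) :
    ∃ H : L, E ≤ H ∧ ¬ P ≤ H ∧ HasRank.rank H + 1 = HasRank.rank (⊤ : L) := by
  obtain ⟨C, hC⟩ := exists_isCompl (E ⊔ P)
  have hlt : HasRank.rank (E ⊓ P) < HasRank.rank P :=
    h.rank_strictMono (lt_of_le_of_ne inf_le_right fun he => hE (he ▸ inf_le_left))
  have h1 := h.rank_sup_add_rank_inf E P
  have h2 := h.rank_sup_add_rank_inf (E ⊔ P) C
  have h3 := h.rank_sup_add_rank_inf E C
  have h4 : E ⊓ C = ⊥ := le_bot_iff.1 ((inf_le_inf_right C le_sup_left).trans hC.inf_eq_bot.le)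
  rw [hC.sup_eq_top, hC.inf_eq_bot, h.rank_bot] at h2
  rw [h4, h.rank_bot] at h3
  refine ⟨E ⊔ C, le_sup_left, fun hle => ?_, by omega⟩
  have : E ⊔ C = ⊤ := top_le_iff.1 <| hC.sup_eq_top.ge.trans <|
    sup_le (sup_le le_sup_left hle) le_sup_right
  rw [this] at h3
  omega

/-! ### Row spaces, degrees, and vanishing of weights off the point -/

section RowSpace

variable {L : Type*} [Lattice L] [BoundedOrder L] [HasRank L] [Finite L] {a : ℕ → ℝ}

theorem phiUp_injective (h : IsUniformlyGraded (HasRank.rank : L → ℕ) a) {i k : ℕ} (hik : i ≤ k)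
    (hn : i + k ≤ HasRank.rank (⊤ : L)) : Function.Injective (phiUp L i k) := by
  have := Fintype.ofFinite L
  rw [injective_iff_map_eq_zero]
  intro w hw
  have h0 := h.eq_zero_of_orderMatrix_mulVec (supportedAt_levelExtend w) hik hn fun y hy => by
    exact (orderMatrix_mulVec_levelExtend w (⟨y, hy⟩ : Level L k)).trans (congrFun hw _)
  ext I
  rw [← levelExtend_apply w I, h0, Pi.zero_apply, Pi.zero_apply]

theorem rowSpace_mono (h : IsUniformlyGraded (HasRank.rank : L → ℕ) a) {i j k : ℕ} (hij : i ≤ j)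
    (hjk : j ≤ k) : rowSpace L i k ≤ rowSpace L j k := by
  have := Fintype.ofFinite L
  rintro _ ⟨w, rfl⟩
  obtain ⟨w', hw', hww'⟩ := h.exists_supportedAt_of_le (supportedAt_levelExtend w) hij hjk
  refine ⟨fun I => w' I.1, ?_⟩
  ext K
  rw [phiUp_restrict hw', hww' K.1 K.2, orderMatrix_mulVec_levelExtend]

theorem card_level {L : Type*} [HasRank L] [Finite L] (k : ℕ) :
    Fintype.card (Level L k) = {x : L | HasRank.rank x = k}.ncard := by
  rw [← Nat.card_eq_fintype_card]
  rfl

theorem rowSpace_min_eq_top (h : IsUniformlyGraded (HasRank.rank : L → ℕ) a) {k : ℕ}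
    (hk : k ≤ HasRank.rank (⊤ : L)) :
    rowSpace L (min k (HasRank.rank (⊤ : L) - k)) k = ⊤ := by
  have := Fintype.ofFinite L
  have hinj := phiUp_injective h (i := min k (HasRank.rank (⊤ : L) - k)) (k := k) (by omega)
    (by omega)
  have hc : Fintype.card (Level L (min k (HasRank.rank (⊤ : L) - k))) =
      Fintype.card (Level L k) := by
    rcases le_total k (HasRank.rank (⊤ : L) - k) with hle | hle
    · rw [min_eq_left hle]
    · rw [min_eq_right hle, card_level, card_level, h.ncard_rank_eq_ncard_corank hk]
  exact LinearMap.range_eq_top.2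
    ((LinearMap.injective_iff_surjective_of_finrank_eq_finrank (by simp [hc])).1 hinj)

/-- The row spaces increase and exhaust the whole space, so the infimum defining the degree runs
over a nonempty set and membership is inherited upwards. -/
theorem degree_le_iff (h : IsUniformlyGraded (HasRank.rank : L → ℕ) a) {k t : ℕ}
    (hk : k ≤ HasRank.rank (⊤ : L)) (ht : t ≤ min k (HasRank.rank (⊤ : L) - k))
    (f : Level L k → ℝ) : degree f ≤ (t : WithBot ℕ) ↔ f ∈ rowSpace L t k := by
  rw [degree]
  split_ifs with hf
  · simp [hf]
  · rw [Nat.cast_le]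
    constructor
    · intro hle
      have hmem := Nat.sInf_mem
        (s := {t : ℕ | t ≤ min k (HasRank.rank (⊤ : L) - k) ∧ f ∈ rowSpace L t k})
        ⟨_, le_rfl, by rw [rowSpace_min_eq_top h hk]; trivial⟩
      exact rowSpace_mono h hle (ht.trans (min_le_left _ _)) hmem.2
    · exact fun hmem => Nat.sInf_le ⟨ht, hmem⟩

theorem degree_le (h : IsUniformlyGraded (HasRank.rank : L → ℕ) a) {k : ℕ}
    (hk : k ≤ HasRank.rank (⊤ : L)) (f : Level L k → ℝ) :
    degree f ≤ ((min k (HasRank.rank (⊤ : L) - k) : ℕ) : WithBot ℕ) :=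
  (degree_le_iff h hk le_rfl f).2 (by rw [rowSpace_min_eq_top h hk]; trivial)

theorem degree_zero {k : ℕ} : degree (0 : Level L k → ℝ) = ⊥ :=
  if_pos rfl

theorem degree_eq_coe {k : ℕ} {f : Level L k → ℝ} (hf : f ≠ 0) :
    ∃ d : ℕ, degree f = (d : WithBot ℕ) :=
  ⟨_, if_neg hf⟩

open Matrix in
/-- If the weights `w` induce a function vanishing outside the elements above the point `P`, then
`w` itself vanishes outside the elements above `P`. -/
theorem eq_zero_of_not_le [ComplementedLattice L]
    (h : IsUniformlyGraded (HasRank.rank : L → ℕ) a) {P : L} (hP : HasRank.rank P = 1) {t k : ℕ}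
    (htk : t ≤ k) (hn : t + k < HasRank.rank (⊤ : L)) {w : Level L t → ℝ}
    (hw : ∀ K : Level L k, ¬ P ≤ K.1 → phiUp L t k w K = 0) {E : Level L t} (hE : ¬ P ≤ E.1) :
    w E = 0 := by
  classical
  have := Fintype.ofFinite L
  obtain ⟨H, hEH, hPH, hH⟩ := exists_rank_succ_of_not_le h hP hE
  have hv : SupportedAt (fun x : Set.Iic H => HasRank.rank x.1) t fun x => levelExtend w x.1 :=
    fun x hx => supportedAt_levelExtend w x.1 hx
  -- Uniqueness of weights inside `H`. Everything below a `k`-element of `H` is already in `H`, so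
  -- the sums over `H` and over the whole lattice agree.
  have h0 := (h.restrict_Iic H).eq_zero_of_orderMatrix_mulVec hv htk
    (show t + k ≤ HasRank.rank H by omega) fun y hy => by
      rw [← hw ⟨y.1, hy⟩ fun hle => hPH (hle.trans y.2),
        ← orderMatrix_mulVec_levelExtend w (⟨y.1, hy⟩ : Level L k)]
      simp only [Matrix.mulVec, dotProduct, orderMatrix, Matrix.of_apply]
      refine Finset.sum_of_injOn (fun x : Set.Iic H => x.1) Subtype.val_injective.injOn
        (by simp) (fun x _ hx => ?_) (fun I _ => by simp)
      rw [if_neg fun hle => hx ⟨⟨x, hle.trans y.2⟩, by simp, rfl⟩, zero_mul]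
  rw [← levelExtend_apply w E]
  exact congrFun h0 ⟨E.1, hEH⟩

end RowSpace

/-! ### Quotients by a point and extension by zero -/

/-- An order isomorphism from `Q` onto the elements above the point `P`, shifting ranks by one:
it exhibits `Q` as the lattice of the quotient by `P`. -/
structure QuotientIso (Q : Type*) {L : Type*} [LE Q] [HasRank Q] [Preorder L] [HasRank L]
    (P : L) where
  /-- the underlying order isomorphism -/
  iso : Q ≃o Set.Ici P
  rank_iso : ∀ J, HasRank.rank (iso J).1 = HasRank.rank J + 1

theorem QuotientIso.rank_top {L Q : Type*} [PartialOrder L] [OrderTop L]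
    [HasRank L] [PartialOrder Q] [OrderTop Q] [HasRank Q] {P : L} (e : QuotientIso Q P) :
    HasRank.rank (⊤ : L) = HasRank.rank (⊤ : Q) + 1 := by
  rw [← e.rank_iso ⊤, e.iso.map_top]
  rfl

section PointExtension

variable {L Q : Type*} [PartialOrder L] [HasRank L] [PartialOrder Q] [HasRank Q] {P : L}

/-- The quotient of an element of rank `k` above `P`. -/
def QuotientIso.quot (e : QuotientIso Q P) {k : ℕ} (K : Level L k) (h : P ≤ K.1) :
    Level Q (k - 1) :=
  ⟨e.iso.symm ⟨K.1, h⟩, by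
    have h1 := e.rank_iso (e.iso.symm ⟨K.1, h⟩)
    have h2 := K.2
    rw [OrderIso.apply_symm_apply] at h1
    change HasRank.rank K.1 = _ at h1
    omega⟩

/-- The element of rank `k` above `P` with a given quotient. -/
def QuotientIso.lift (e : QuotientIso Q P) {k : ℕ} (hk : 1 ≤ k) (J : Level Q (k - 1)) :
    Level L k :=
  ⟨(e.iso J.1).1, by
    have h1 := e.rank_iso J.1
    have h2 := J.2
    omega⟩

theorem QuotientIso.le_lift (e : QuotientIso Q P) {k : ℕ} (hk : 1 ≤ k) (J : Level Q (k - 1)) :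
    P ≤ (e.lift hk J).1 :=
  (e.iso J.1).2

theorem QuotientIso.quot_lift (e : QuotientIso Q P) {k : ℕ} (hk : 1 ≤ k) (J : Level Q (k - 1)) :
    e.quot (e.lift hk J) (e.le_lift hk J) = J :=
  Subtype.ext (e.iso.symm_apply_apply J.1)

theorem QuotientIso.lift_quot (e : QuotientIso Q P) {k : ℕ} (hk : 1 ≤ k) (K : Level L k)
    (h : P ≤ K.1) : e.lift hk (e.quot K h) = K :=
  Subtype.ext (congrArg (fun x : Set.Ici P => x.1) (e.iso.apply_symm_apply ⟨K.1, h⟩))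

theorem QuotientIso.lift_injective (e : QuotientIso Q P) {k : ℕ} (hk : 1 ≤ k) :
    Function.Injective (e.lift hk) := fun J J' h => by
  have h1 := e.quot_lift hk J
  have h2 := e.quot_lift hk J'
  simp only [h] at h1
  exact h1.symm.trans h2

theorem QuotientIso.lift_le_iff (e : QuotientIso Q P) {t k : ℕ} (ht : 1 ≤ t)
    (J : Level Q (t - 1)) (K : Level L k) (h : P ≤ K.1) :
    (e.lift ht J).1 ≤ K.1 ↔ J.1 ≤ (e.quot K h).1 := by
  rw [QuotientIso.quot, e.iso.le_symm_apply]
  rfl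

open Classical in
/-- Extension by zero of a function on the quotient by `P`. -/
noncomputable def QuotientIso.extend (e : QuotientIso Q P) (k : ℕ) (f : Level Q (k - 1) → ℝ) :
    Level L k → ℝ :=
  fun K => if h : P ≤ K.1 then f (e.quot K h) else 0

theorem QuotientIso.extend_lift (e : QuotientIso Q P) {k : ℕ} (hk : 1 ≤ k)
    (f : Level Q (k - 1) → ℝ) (J : Level Q (k - 1)) : e.extend k f (e.lift hk J) = f J := by
  rw [QuotientIso.extend, dif_pos (e.le_lift hk J), e.quot_lift]

theorem QuotientIso.extend_of_not_le (e : QuotientIso Q P) {k : ℕ} (f : Level Q (k - 1) → ℝ)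
    {K : Level L k} (h : ¬ P ≤ K.1) : e.extend k f K = 0 :=
  dif_neg h

theorem QuotientIso.extend_comp_lift (e : QuotientIso Q P) {k : ℕ} (hk : 1 ≤ k)
    {g : Level L k → ℝ} (hg : ∀ K : Level L k, ¬ P ≤ K.1 → g K = 0) :
    e.extend k (g ∘ e.lift hk) = g := by
  ext K
  by_cases h : P ≤ K.1
  · rw [← e.lift_quot hk K h, e.extend_lift]
    rfl
  · rw [e.extend_of_not_le _ h, hg K h]

theorem QuotientIso.isLinearMap_extend (e : QuotientIso Q P) (k : ℕ) :
    IsLinearMap ℝ (e.extend k) where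
  map_add f g := by
    ext K
    by_cases h : P ≤ K.1 <;> simp [QuotientIso.extend, h]
  map_smul c f := by
    ext K
    by_cases h : P ≤ K.1 <;> simp [QuotientIso.extend, h]

theorem QuotientIso.extend_injective (e : QuotientIso Q P) {k : ℕ} (hk : 1 ≤ k) :
    Function.Injective (e.extend k) := fun f g h => by
  ext J
  rw [← e.extend_lift hk f, h, e.extend_lift]

theorem QuotientIso.extend_zero (e : QuotientIso Q P) (k : ℕ) : e.extend k 0 = 0 :=
  (e.isLinearMap_extend k).map_zero

theorem QuotientIso.range_extend (e : QuotientIso Q P) {k : ℕ} (hk : 1 ≤ k) :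
    Set.range (e.extend k) =
      {g : Level L k → ℝ | Function.support g ⊆ {K | P ≤ K.1}} := by
  ext g
  constructor
  · rintro ⟨f, rfl⟩ K hK
    by_contra h
    exact hK (e.extend_of_not_le f h)
  · intro hg
    refine ⟨g ∘ e.lift hk, e.extend_comp_lift hk fun K hK => ?_⟩
    by_contra h
    exact hK (hg h)

end PointExtension

/-! ### Degree and weights of the extension -/

section PointExtensionDegree

variable {L Q : Type*} [Lattice L] [HasRank L] [Finite L] [Lattice Q] [HasRank Q] [Finite Q] {P : L}

/-- Only `I` above `P` contribute, and these lie below `K` exactly when `P ≤ K` and `I/P ≤ K/P`. -/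
theorem QuotientIso.phiUp_extend (e : QuotientIso Q P) {t : ℕ} (ht : 1 ≤ t) (k : ℕ)
    (w : Level Q (t - 1) → ℝ) :
    phiUp L t k (e.extend t w) = e.extend k (phiUp Q (t - 1) (k - 1) w) := by
  classical
  ext K
  rw [phiUp_apply]
  by_cases h : P ≤ K.1
  · rw [QuotientIso.extend, dif_pos h, phiUp_apply]
    symm
    refine Finset.sum_of_injOn (e.lift ht) (e.lift_injective ht).injOn (by simp)
      (fun I _ hI => ?_) (fun J _ => ?_)
    · rw [e.extend_of_not_le w fun hPI => hI ⟨e.quot I hPI, by simp, e.lift_quot ht I hPI⟩,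
        ite_self]
    · rw [e.extend_lift]
      simp only [e.lift_le_iff ht J K h]
  · rw [e.extend_of_not_le _ h]
    refine Finset.sum_eq_zero fun I _ => ?_
    split_ifs with hI
    · exact e.extend_of_not_le w fun hPI => h (hPI.trans hI)
    · rfl

theorem QuotientIso.isWeight_extend (e : QuotientIso Q P) {t k : ℕ} (ht : 1 ≤ t)
    {w : Level Q (t - 1) → ℝ} {f : Level Q (k - 1) → ℝ} (hw : IsWeight w f) :
    IsWeight (e.extend t w) (e.extend k f) := by
  rw [IsWeight, e.phiUp_extend ht, hw]

variable [BoundedOrder L] {a : ℕ → ℝ}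

theorem QuotientIso.mem_rowSpace_of_extend [ComplementedLattice L]
    (h : IsUniformlyGraded (HasRank.rank : L → ℕ) a) (hP : HasRank.rank P = 1)
    (e : QuotientIso Q P) {t k : ℕ} (hk : 1 ≤ k) (htk : t ≤ k)
    (hn : t + k < HasRank.rank (⊤ : L)) {f : Level Q (k - 1) → ℝ} (hf : f ≠ 0)
    (hmem : e.extend k f ∈ rowSpace L t k) : 1 ≤ t ∧ f ∈ rowSpace Q (t - 1) (k - 1) := by
  obtain ⟨w, hw⟩ := hmem
  have hw0 : ∀ E : Level L t, ¬ P ≤ E.1 → w E = 0 := fun E hE =>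
    eq_zero_of_not_le h hP htk hn
      (fun K hK => by rw [hw]; exact e.extend_of_not_le f hK) hE
  -- A rank-zero element is never above `P`, so `0`-weights would all vanish, contradicting `f ≠ 0`.
  rcases Nat.eq_zero_or_pos t with rfl | ht
  · have : w = 0 := by
      ext E
      refine hw0 E fun hle => ?_
      have h1 := h.rank_mono hle
      have h2 := E.2
      omega
    rw [this, map_zero, ← e.extend_zero] at hw
    exact absurd (e.extend_injective hk hw.symm) hf
  · refine ⟨ht, w ∘ e.lift ht, e.extend_injective hk ?_⟩
    rw [← e.phiUp_extend ht, e.extend_comp_lift ht hw0, hw]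

variable [BoundedOrder Q]

theorem QuotientIso.degree_extend [ComplementedLattice L]
    (hL : IsUniformlyGraded (HasRank.rank : L → ℕ) a)
    (hQ : IsUniformlyGraded (HasRank.rank : Q → ℕ) a) (hP : HasRank.rank P = 1)
    (e : QuotientIso Q P) {k : ℕ} (hk : 1 ≤ k) (hkn : k ≤ HasRank.rank (⊤ : L))
    (f : Level Q (k - 1) → ℝ) :
    degree (e.extend k f) =
      min (degree f + 1) ((HasRank.rank (⊤ : L) - k : ℕ) : WithBot ℕ) := by
  have hn := e.rank_top
  by_cases hf : f = 0
  · rw [hf, e.extend_zero, degree_zero, degree_zero]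
    simp
  have hf' : e.extend k f ≠ 0 := fun h =>
    hf (e.extend_injective hk (h.trans (e.extend_zero k).symm))
  obtain ⟨d, hd⟩ := degree_eq_coe hf
  obtain ⟨d', hd'⟩ := degree_eq_coe hf'
  have hdle := degree_le hQ (by omega) f
  have hdle' := degree_le hL hkn (e.extend k f)
  rw [hd, Nat.cast_le] at hdle
  rw [hd', Nat.cast_le] at hdle'
  have h1 : d + 1 ≤ HasRank.rank (⊤ : L) - k → d' ≤ d + 1 := by
    intro hle
    obtain ⟨w, hw⟩ := (degree_le_iff hQ (by omega) hdle f).1 hd.le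
    have := (degree_le_iff hL hkn (t := d + 1) (by omega) (e.extend k f)).2
      ⟨_, e.isWeight_extend (Nat.succ_pos d) hw⟩
    rwa [hd', Nat.cast_le] at this
  have h2 : d' < HasRank.rank (⊤ : L) - k → d + 1 ≤ d' := by
    intro hlt
    obtain ⟨h1, h2⟩ := e.mem_rowSpace_of_extend hL hP hk (by omega) (by omega) hf
      ((degree_le_iff hL hkn hdle' _).1 hd'.le)
    have := (degree_le_iff hQ (by omega) (by omega) f).2 h2
    rw [hd, Nat.cast_le] at this
    omega
  -- Below the cap `h1` and `h2` give both inequalities; if `d + 1` exceeds the cap, `h2` excludes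
  -- `d' < n - k`, and `d' ≤ n - k` always holds.
  have key : d' = min (d + 1) (HasRank.rank (⊤ : L) - k) := by omega
  rw [hd', hd, key]
  norm_cast

theorem QuotientIso.wt_extend
    (hL : IsUniformlyGraded (HasRank.rank : L → ℕ) a)
    (hQ : IsUniformlyGraded (HasRank.rank : Q → ℕ) a)
    (e : QuotientIso Q P) {k : ℕ} (hk : 1 ≤ k) (hkn : k ≤ HasRank.rank (⊤ : L))
    (f : Level Q (k - 1) → ℝ) {t : ℕ} (hft : max (degree f) 0 + 1 ≤ (t : WithBot ℕ))
    (htk : t ≤ min k (HasRank.rank (⊤ : L) - k)) :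
    (∃! w : Level Q (t - 1) → ℝ, IsWeight w f) ∧
      (∃! w : Level L t → ℝ, IsWeight w (e.extend k f)) ∧
      wt t (e.extend k f) = e.extend t (wt (t - 1) f) := by
  have hn := e.rank_top
  -- The maximum with `0` is what forces this for `f = 0`, whose degree is `⊥`.
  have ht : 1 ≤ t := by
    have : (0 : WithBot ℕ) + 1 ≤ (t : WithBot ℕ) :=
      (add_le_add_left (le_max_right _ _) 1).trans hft
    exact_mod_cast this
  have hdeg : degree f ≤ ((t - 1 : ℕ) : WithBot ℕ) := by
    by_cases hf : f = 0
    · rw [hf, degree_zero]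
      exact bot_le
    · obtain ⟨d, hd⟩ := degree_eq_coe hf
      have : degree f + 1 ≤ (t : WithBot ℕ) :=
        (add_le_add_left (le_max_left _ _) 1).trans hft
      rw [hd] at this ⊢
      have : d + 1 ≤ t := by exact_mod_cast this
      exact Nat.cast_le.2 (by omega)
  have iQ : Function.Injective (phiUp Q (t - 1) (k - 1)) :=
    phiUp_injective hQ (by omega) (by omega)
  have iL : Function.Injective (phiUp L t k) := phiUp_injective hL (by omega) (by omega)
  obtain ⟨w, hw⟩ := mem_rowSpace_iff.1 ((degree_le_iff hQ (by omega) (by omega) f).1 hdeg)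
  have hw' := e.isWeight_extend ht hw
  exact ⟨existsUnique_isWeight iQ hw, existsUnique_isWeight iL hw',
    by rw [wt_eq_of_isWeight iL hw', wt_eq_of_isWeight iQ hw]⟩

end PointExtensionDegree

/-! ### The lattice of subsets -/

section SetLattice

theorem isUniformlyGraded_set (V : Type*) [Finite V] :
    IsUniformlyGraded (HasRank.rank : Set V → ℕ) fun m => (m : ℝ) where
  atoms_strictMono := Nat.strictMono_cast
  rank_strictMono := fun _ _ h => Set.ncard_lt_ncard h (Set.toFinite _)
  rank_bot := Set.ncard_empty V
  rank_sup_add_rank_inf := fun x y => Set.ncard_union_add_ncard_inter x y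
  ncard_atoms := fun x y hxy => by
    change (_ : ℝ) = ((y.ncard - x.ncard : ℕ) : ℝ)
    rw [← Set.ncard_sdiff hxy (Set.toFinite x)]
    have : {z : Set V | x ≤ z ∧ z ≤ y ∧ HasRank.rank z = HasRank.rank x + 1} =
        (fun v => insert v x) '' (y \ x) := by
      ext z
      simp only [Set.mem_ofPred_eq, Set.mem_image]
      constructor
      · rintro ⟨h1, h2, h3⟩
        have h4 : (z \ x).ncard = 1 := by
          have h3 : z.ncard = x.ncard + 1 := h3
          rw [Set.ncard_sdiff h1 (Set.toFinite x)]
          omega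
        obtain ⟨v, hv⟩ := Set.ncard_eq_one.1 h4
        have hvz : v ∈ z \ x := hv ▸ Set.mem_singleton v
        refine ⟨v, ⟨h2 hvz.1, hvz.2⟩, ?_⟩
        rw [Set.insert_eq, ← hv, Set.sdiff_union_of_subset h1]
      · rintro ⟨v, hv, rfl⟩
        exact ⟨Set.subset_insert v x, Set.insert_subset hv.1 hxy,
          Set.ncard_insert_of_notMem hv.2 (Set.toFinite x)⟩
    rw [this, Set.InjOn.ncard_image]
    intro v hv w hw hvw
    have : v ∈ insert w x := by
      have hvw : insert v x = insert w x := hvw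
      exact hvw ▸ Set.mem_insert v x
    exact this.resolve_right hv.2

/-- The subsets of the complement of `P` correspond to the sets containing `P`. -/
def setQuotientIso {V : Type*} [Finite V] (P : Level (Set V) 1) :
    QuotientIso (Set ↥(P.1ᶜ)) P.1 where
  iso :=
    { toFun := fun J => ⟨Subtype.val '' J ∪ P.1, Set.subset_union_right⟩
      invFun := fun K => Subtype.val ⁻¹' K.1
      left_inv := fun J => by
        ext x
        have := x.2
        simp_all
      right_inv := fun K => by
        have hK : P.1 ⊆ K.1 := K.2
        refine Subtype.ext ?_
        ext x
        have := @hK x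
        by_cases hx : x ∈ P.1 <;> simp_all
      map_rel_iff' := fun {J J'} => by
        constructor
        · intro h x hx
          have h1 : x.1 ∈ Subtype.val '' J' ∪ P.1 := h (Or.inl ⟨x, hx, rfl⟩)
          rcases h1 with ⟨x', hx', he⟩ | h1
          · rwa [← Subtype.ext he]
          · exact absurd h1 x.2
        · exact fun h => Set.union_subset_union_left _ (Set.image_mono h) }
  rank_iso := fun J => by
    change (Subtype.val '' J ∪ P.1).ncard = J.ncard + 1
    have hP : P.1.ncard = 1 := P.2
    rw [Set.ncard_union_eq, Set.ncard_image_of_injective _ Subtype.val_injective, hP]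
    rw [Set.disjoint_left]
    rintro _ ⟨x, -, rfl⟩
    exact x.2

end SetLattice

/-! ### The lattice of subspaces over a finite field -/

section SubspaceLattice

variable {F V : Type*} [Field F] [AddCommGroup V] [Module F V] [Module.Finite F V]

theorem ncard_subspace (x : Submodule F V) :
    (x : Set V).ncard = Nat.card F ^ Module.finrank F x :=
  Module.natCard_eq_pow_finrank (K := F) (V := x)

theorem finrank_sup_span_singleton {x : Submodule F V} {v : V} (hv : v ∉ x) :
    Module.finrank F ↥(x ⊔ F ∙ v) = Module.finrank F x + 1 := by
  have h0 : v ≠ 0 := fun h => hv (h ▸ x.zero_mem)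
  have h1 := Submodule.finrank_sup_add_finrank_inf_eq x (F ∙ v)
  have h2 : x ⊓ F ∙ v = ⊥ := by
    rw [← disjoint_iff, disjoint_comm]
    exact (Submodule.disjoint_span_singleton_of_notMem hv).symm
  rwa [h2, finrank_bot, finrank_span_singleton h0, add_zero] at h1

/-- The vectors of `y` outside `x` are sorted by the subspace `x ⊔ F ∙ v`; the fibre over `z` is `z`
minus `x`. -/
theorem ncard_covers_subspace [Finite F] {x y : Submodule F V} (hxy : x ≤ y) :
    {z : Submodule F V | x ≤ z ∧ z ≤ y ∧ Module.finrank F z = Module.finrank F x + 1}.ncard *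
      (Nat.card F ^ (Module.finrank F x + 1) - Nat.card F ^ Module.finrank F x) =
        Nat.card F ^ Module.finrank F y - Nat.card F ^ Module.finrank F x := by
  classical
  have : Finite V := Module.finite_of_finite F
  have := Fintype.ofFinite V
  have := Fintype.ofFinite (Submodule F V)
  set S : Finset (Submodule F V) := Finset.univ.filter fun z =>
    x ≤ z ∧ z ≤ y ∧ Module.finrank F z = Module.finrank F x + 1 with hS
  set T : Finset V := Finset.univ.filter fun v => v ∈ y ∧ v ∉ x with hT
  have card_diff : ∀ z : Submodule F V, x ≤ z →
      (Finset.univ.filter fun v => v ∈ z ∧ v ∉ x).card =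
        Nat.card F ^ Module.finrank F z - Nat.card F ^ Module.finrank F x := by
    intro z hz
    rw [← ncard_subspace, ← ncard_subspace, ← Set.ncard_sdiff hz (Set.toFinite _),
      ← Set.ncard_coe_finset]
    congr 1
    ext v
    simp
  have hmaps : Set.MapsTo (fun v => x ⊔ F ∙ v) (T : Set V) (S : Set (Submodule F V)) := by
    intro v hv
    simp only [hT, Finset.coe_filter, Finset.mem_univ, true_and, Set.mem_ofPred_eq] at hv
    simp only [hS, Finset.coe_filter, Finset.mem_univ, true_and, Set.mem_ofPred_eq]
    exact ⟨le_sup_left, sup_le hxy ((Submodule.span_singleton_le_iff_mem _ _).2 hv.1),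
      finrank_sup_span_singleton hv.2⟩
  have key := Finset.card_eq_sum_card_fiberwise hmaps
  have fib : ∀ z ∈ S, (T.filter fun v => x ⊔ F ∙ v = z).card =
      Nat.card F ^ (Module.finrank F x + 1) - Nat.card F ^ Module.finrank F x := by
    intro z hz
    simp only [hS, Finset.mem_filter, Finset.mem_univ, true_and] at hz
    rw [← hz.2.2, ← card_diff z hz.1]
    congr 1
    ext v
    simp only [hT, Finset.mem_filter, Finset.mem_univ, true_and]
    constructor
    · rintro ⟨h1, rfl⟩
      exact ⟨Submodule.mem_sup_right (Submodule.mem_span_singleton_self v), h1.2⟩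
    · rintro ⟨h1, h2⟩
      refine ⟨⟨hz.2.1 h1, h2⟩, Submodule.eq_of_le_of_finrank_eq
        (sup_le hz.1 ((Submodule.span_singleton_le_iff_mem _ _).2 h1)) ?_⟩
      rw [finrank_sup_span_singleton h2, hz.2.2]
  rw [Finset.sum_congr rfl fib, Finset.sum_const, smul_eq_mul, card_diff y hxy] at key
  rw [key, ← Set.ncard_coe_finset, hS]
  simp

theorem isUniformlyGraded_submodule (F V : Type*) [Field F] [Finite F] [AddCommGroup V]
    [Module F V] [Module.Finite F V] :
    IsUniformlyGraded (HasRank.rank : Submodule F V → ℕ)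
      fun m => ((Nat.card F : ℝ) ^ m - 1) / (Nat.card F - 1) where
  atoms_strictMono := fun m m' h => by
    have hq : (1 : ℝ) < Nat.card F := by exact_mod_cast Finite.one_lt_card
    have := pow_lt_pow_right₀ hq h
    have hq' : (0 : ℝ) < Nat.card F - 1 := sub_pos.2 hq
    change _ / _ < _ / _
    gcongr
  rank_strictMono := fun _ _ h => Submodule.finrank_lt_finrank_of_lt h
  rank_bot := finrank_bot F V
  rank_sup_add_rank_inf := fun x y => Submodule.finrank_sup_add_finrank_inf_eq x y
  ncard_atoms := fun x y hxy => by
    have hq : (1 : ℝ) < Nat.card F := by exact_mod_cast Finite.one_lt_card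
    have hq0 : (0 : ℝ) < Nat.card F := by linarith
    have hq' : (0 : ℝ) < Nat.card F - 1 := sub_pos.2 hq
    have key := ncard_covers_subspace hxy
    have hle : Module.finrank F x ≤ Module.finrank F y := Submodule.finrank_mono hxy
    have key' := congrArg (Nat.cast : ℕ → ℝ) key
    rw [Nat.cast_mul, Nat.cast_sub (Nat.pow_le_pow_right Nat.card_pos (Nat.le_succ _)),
      Nat.cast_sub (Nat.pow_le_pow_right Nat.card_pos hle)] at key'
    push_cast at key'
    change ({z : Submodule F V | x ≤ z ∧ z ≤ y ∧
      Module.finrank F z = Module.finrank F x + 1}.ncard : ℝ) =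
        ((Nat.card F : ℝ) ^ (Module.finrank F y - Module.finrank F x) - 1) / (Nat.card F - 1)
    obtain ⟨r, hr⟩ := Nat.exists_eq_add_of_le hle
    rw [hr, pow_add, pow_succ] at key'
    rw [hr, Nat.add_sub_cancel_left, eq_div_iff hq'.ne']
    -- Both sides of the count carry the common factor `q ^ rk x`, which is cancelled.
    have hp : (0 : ℝ) < (Nat.card F : ℝ) ^ Module.finrank F x := pow_pos hq0 _
    refine mul_left_cancel₀ hp.ne' ?_
    linarith

/-- The subspaces of `V ⧸ P` correspond to the subspaces containing `P`. -/
def spaceQuotientIso {F V : Type*} [Field F] [AddCommGroup V] [Module F V] [Module.Finite F V]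
    (P : Level (Submodule F V) 1) : QuotientIso (Submodule F (V ⧸ P.1)) P.1 where
  iso := Submodule.comapMkQRelIso P.1
  rank_iso := fun J => by
    have hP : Module.finrank F P.1 = 1 := P.2
    have hle : P.1 ≤ J.comap P.1.mkQ := Submodule.le_comap_mkQ P.1 J
    have h1 := finrank_map_mkQ P.1 _ hP hle
    rw [Submodule.map_comap_eq_of_surjective P.1.mkQ_surjective] at h1
    have h2 := Submodule.finrank_mono hle
    change Module.finrank F (J.comap P.1.mkQ) = Module.finrank F J + 1
    omega

end SubspaceLattice

/-! ### The theorem in both cases -/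

open Classical in
theorem theorem6p3 :
    -- the set case
    (∀ (V : Type*) [Finite V] (P : Level (Set V) 1) (k : ℕ), 1 ≤ k → k ≤ Nat.card V →
      IsLinearMap ℝ (setPhi P k) ∧
      Function.Injective (setPhi P k) ∧
      Set.range (setPhi P k) =
        {g : Level (Set V) k → ℝ | Function.support g ⊆ {K | P.1 ≤ K.1}} ∧
      ∀ f : Level (Set ↥(P.1ᶜ)) (k - 1) → ℝ,
        degree (setPhi P k f) = min (degree f + 1) ((Nat.card V - k : ℕ) : WithBot ℕ) ∧
        ∀ e : ℕ, max (degree f) 0 + 1 ≤ (e : WithBot ℕ) → e ≤ min k (Nat.card V - k) →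
          (∃! w : Level (Set ↥(P.1ᶜ)) (e - 1) → ℝ, IsWeight w f) ∧
          (∃! w : Level (Set V) e → ℝ, IsWeight w (setPhi P k f)) ∧
          ∀ E : Level (Set V) e,
            wt e (setPhi P k f) E =
              if h : P.1 ≤ E.1 then wt (e - 1) f (setMod P E h) else 0) ∧
    -- the vector space case
    (∀ (F V : Type*) [Field F] [Finite F] [AddCommGroup V] [Module F V] [Module.Finite F V]
      (P : Level (Submodule F V) 1) (k : ℕ), 1 ≤ k → k ≤ Module.finrank F V →
      IsLinearMap ℝ (spacePhi P k) ∧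
      Function.Injective (spacePhi P k) ∧
      Set.range (spacePhi P k) =
        {g : Level (Submodule F V) k → ℝ | Function.support g ⊆ {K | P.1 ≤ K.1}} ∧
      ∀ f : Level (Submodule F (V ⧸ P.1)) (k - 1) → ℝ,
        degree (spacePhi P k f) =
          min (degree f + 1) ((Module.finrank F V - k : ℕ) : WithBot ℕ) ∧
        ∀ e : ℕ, max (degree f) 0 + 1 ≤ (e : WithBot ℕ) → e ≤ min k (Module.finrank F V - k) →
          (∃! w : Level (Submodule F (V ⧸ P.1)) (e - 1) → ℝ, IsWeight w f) ∧
          (∃! w : Level (Submodule F V) e → ℝ, IsWeight w (spacePhi P k f)) ∧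
          ∀ E : Level (Submodule F V) e,
            wt e (spacePhi P k f) E =
              if h : P.1 ≤ E.1 then wt (e - 1) f (spaceMod P E h) else 0) := by
  refine ⟨fun V _ P k hk hkn => ?_, fun F V _ _ _ _ _ P k hk hkn => ?_⟩
  · have hn : HasRank.rank (⊤ : Set V) = Nat.card V := Set.ncard_univ V
    have hL := isUniformlyGraded_set V
    have hQ := isUniformlyGraded_set ↥(P.1ᶜ)
    -- The inverse of this isomorphism unfolds to `setMod`, so `setPhi P k` and `e.extend k` agree
    -- definitionally and the general results apply verbatim; likewise for `spacePhi` below.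
    let e := setQuotientIso P
    rw [← hn] at hkn ⊢
    refine ⟨e.isLinearMap_extend k, e.extend_injective hk, e.range_extend hk, fun f =>
      ⟨e.degree_extend hL hQ P.2 hk hkn f, fun t hft ht => ?_⟩⟩
    obtain ⟨h1, h2, h3⟩ := e.wt_extend hL hQ hk hkn f hft ht
    exact ⟨h1, h2, fun E => congrFun h3 E⟩
  · have hn : HasRank.rank (⊤ : Submodule F V) = Module.finrank F V := finrank_top F V
    have hL := isUniformlyGraded_submodule F V
    have hQ := isUniformlyGraded_submodule F (V ⧸ P.1)
    let e := spaceQuotientIso P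
    rw [← hn] at hkn ⊢
    refine ⟨e.isLinearMap_extend k, e.extend_injective hk, e.range_extend hk, fun f =>
      ⟨e.degree_extend hL hQ P.2 hk hkn f, fun t hft ht => ?_⟩⟩
    obtain ⟨h1, h2, h3⟩ := e.wt_extend hL hQ hk hkn f hft ht
    exact ⟨h1, h2, fun E => congrFun h3 E⟩
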